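/- All systems are finite-dimensional and $\log$ denotes the logarithm to base $2$. Let $\Lambda(\rho)=\sum_k A_k\rho A_k^\dagger$, with $\sum_k A_k^\dagger A_k=I$, be a quantum channel from a system $A'$ to a system $B$ (Bob), and let the environment $E$ (Eve) be the Hilbert space with orthonormal basis $\{|k\rangle\}$, so that a pure input $|v\rangle$ is mapped to $\sum_k A_k|v\rangle\otimes|k\rangle\in B\otimes E$. Let $N\ge 1$, let $\{|\alpha\rangle\}_{\alpha=1}^N$ be unit vectors of $A'$ (the code; they need not be orthogonal or distinct), and let $\{|\psi_\alpha\rangle\}_{\alpha=1}^N$ be orthonormal vectors of a system $A$ (Alice). Sending the part $A'$ of $|\psi_{AA'}\rangle=\frac1{\sqrt N}\sum_{\alpha=1}^N|\psi_\alpha\rangle|\alpha\rangle$ through the channel gives the pure state $$|\psi_{ABE}\rangle=\frac1{\sqrt N}\sum_{\alpha=1}^N\sum_k|\psi_\alpha\rangle\otimes A_k|\alpha\rangle\otimes|k\rangle ,$$ with reduced states $\sigma_{AE}$ and $\sigma_E$. Let $\tau_A=\frac1N\sum_{\alpha=1}^N|\psi_\alpha\rangle\langle\psi_\alpha|$ be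 the normalized projector of rank $N$ onto the span of the $|\psi_\alpha\rangle$ (so $\tau_A=I/N$ if $\dim A=N$), and define the modified quantum error $$q_e=\|\sigma_{AE}-\tau_A\otimes\sigma_E\|,$$ where $\|M\|=\mathrm{Tr}\sqrt{M^\dagger M}$ is the trace norm. Let $\sigma_B^\alpha=\Lambda(|\alpha\rangle\langle\alpha|)$ and $\sigma_E^\alpha=\sum_{k,k'}\mathrm{Tr}(A_k|\alpha\rangle\langle\alpha|A_{k'}^\dagger)\,|k\rangle\langle k'|$ be the output states of Bob and Eve when $|\alpha\rangle$ is sent, and for $X=B,E$ let $$\mathcal D_X=\chi(\{\tfrac1N,\sigma_X^\alpha\})=S\Big(\frac1N\sum_{\alpha=1}^N\sigma_X^\alpha\Big)-\frac1N\sum_{\alpha=1}^N S(\sigma_X^\alpha),\qquad S(\rho)=-\mathrm{Tr}\,\rho\log\rho .$$ Then $\mathcal D_E+(\log N-\mathcal D_B)\ge 0$ and $$q_e\le\sqrt{2\ln 2}\;\sqrt{\mathcal D_E+(\log N-\mathcal D_B)} .$$ -/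

import Mathlib

open scoped Kronecker

noncomputable section

namespace QCoding

variable {a a' b e n ι : Type*}

/-- The trace norm `‖M‖ = Tr √(Mᴴ M)`. -/
def traceNorm [Fintype n] [DecidableEq n] (M : Matrix n n ℂ) : ℝ :=
  (cfc Real.sqrt (M.conjTranspose * M)).trace.re

/-- The von Neumann entropy `S(ρ) = - Tr (ρ log₂ ρ)`, in bits. The functional calculus uses
`Real.logb 2 0 = 0`, so that `0 log 0 = 0`. -/
def vnEntropy [Fintype n] [DecidableEq n] (ρ : Matrix n n ℂ) : ℝ :=
  -(ρ * cfc (Real.logb 2) ρ).trace.re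

/-- The Holevo quantity `χ({p i, ρ i}) = S(∑ p i ρ i) - ∑ p i S(ρ i)` of an ensemble. -/
def holevo [Fintype ι] [Fintype n] [DecidableEq n] (p : ι → ℝ) (ρ : ι → Matrix n n ℂ) : ℝ :=
  vnEntropy (∑ i, (p i : ℂ) • ρ i) - ∑ i, p i * vnEntropy (ρ i)

/-- The rank-one matrix `|v⟩⟨v|`. -/
def ketBra (v : n → ℂ) : Matrix n n ℂ :=
  Matrix.vecMulVec v (star v)

/-- A quantum channel from the system `a'` to the system `b` together with its environment `e`,
given by Kraus operators labelled by an orthonormal basis of the environment; equivalently, by the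
Stinespring isometry `|v⟩ ↦ ∑ k, (kraus k |v⟩) ⊗ |k⟩`. -/
structure Channel (a' b e : Type*) [Fintype a'] [DecidableEq a'] [Fintype b] [Fintype e] where
  kraus : e → Matrix b a' ℂ
  trace_preserving : ∑ k, (kraus k).conjTranspose * kraus k = 1

section Outputs

variable [Fintype a'] [DecidableEq a'] [Fintype b] [Fintype e]

/-- Bob's output `Λ(ρ) = ∑ k, A k ρ (A k)ᴴ`. -/
def Channel.toBob (Λ : Channel a' b e) (ρ : Matrix a' a' ℂ) : Matrix b b ℂ :=
  ∑ k, Λ.kraus k * ρ * (Λ.kraus k).conjTranspose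

/-- Eve's output (the complementary channel) `∑ k k', Tr (A k ρ (A k')ᴴ) |k⟩⟨k'|`. -/
def Channel.toEve (Λ : Channel a' b e) (ρ : Matrix a' a' ℂ) : Matrix e e ℂ :=
  Matrix.of fun k k' => (Λ.kraus k * ρ * (Λ.kraus k').conjTranspose).trace

/-- The state of Alice, Bob and Eve after the second half of a pure state of `A A'` has gone
through the channel: `∑ k, (I ⊗ A k) |ψ⟩ ⊗ |k⟩`. -/
def Channel.send (Λ : Channel a' b e) (ψ : a × a' → ℂ) : a × b × e → ℂ :=
  fun x => ∑ l, Λ.kraus x.2.2 x.2.1 l * ψ (x.1, l)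

/-- Distinguishability by Bob: the Holevo quantity of his output ensemble for a code. -/
def distB [DecidableEq b] {N : ℕ} (Λ : Channel a' b e) (α : Fin N → EuclideanSpace ℂ a') : ℝ :=
  holevo (fun _ : Fin N => (1 / N : ℝ)) fun i => Λ.toBob (ketBra (α i))

/-- Distinguishability by Eve: the Holevo quantity of her output ensemble for a code. -/
def distE [DecidableEq e] {N : ℕ} (Λ : Channel a' b e) (α : Fin N → EuclideanSpace ℂ a') : ℝ :=
  holevo (fun _ : Fin N => (1 / N : ℝ)) fun i => Λ.toEve (ketBra (α i))

end Outputs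

/-- The superposition `(1/√N) ∑ i, |ψ i⟩ ⊗ |α i⟩` of `A A'` built from a code `α`. -/
def codeState {N : ℕ} (ψ : Fin N → EuclideanSpace ℂ a) (α : Fin N → EuclideanSpace ℂ a') :
    a × a' → ℂ :=
  fun x => ((1 / Real.sqrt N : ℝ) : ℂ) * ∑ i, ψ i x.1 * α i x.2

/-- Partial trace over the middle system. -/
def traceB [Fintype b] (M : Matrix (a × b × e) (a × b × e) ℂ) : Matrix (a × e) (a × e) ℂ :=
  Matrix.of fun x y => ∑ j, M (x.1, j, x.2) (y.1, j, y.2)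

/-- Partial trace over the first system. -/
def traceA [Fintype a] (M : Matrix (a × e) (a × e) ℂ) : Matrix e e ℂ :=
  Matrix.of fun k k' => ∑ i, M (i, k) (i, k')

/-- For an orthonormal family `ψ` of `N` vectors, the normalized projector of rank `N` onto their
span, `(1/N) ∑ i, |ψ i⟩⟨ψ i|`. It is `I/N` if the system has dimension `N`. -/
def maxMixed {N : ℕ} (ψ : Fin N → EuclideanSpace ℂ a) : Matrix a a ℂ :=
  (1 / N : ℂ) • ∑ i, ketBra (ψ i)

/-- The modified quantum error `‖σ_AE - τ_A ⊗ σ_E‖` of the tripartite vector `φ`, where `τ_A` is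
the normalized projector onto the span of the orthonormal family `ψ`. -/
def quantumError [Fintype a] [DecidableEq a] [Fintype b] [Fintype e] [DecidableEq e] {N : ℕ}
    (ψ : Fin N → EuclideanSpace ℂ a) (φ : a × b × e → ℂ) : ℝ :=
  traceNorm (traceB (ketBra φ) - maxMixed ψ ⊗ₖ traceA (traceB (ketBra φ)))

end QCoding

end

/-! For each code word the joint output on `B ⊗ E` is pure, so Bob's and Eve's output states have
equal entropy and the averaged terms of the two Holevo quantities cancel. The global state on `A ⊗ B
⊗ E` is pure too, so `S(σ_B) = S(σ_AE)`. What remains is `S(σ_E) + log N - S(σ_AE)`, the relative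
entropy of `σ_AE` with respect to `τ_A ⊗ σ_E`, and the bound is quantum Pinsker
(`sq_re_trace_mul_sub_mixed_le`).

Pinsker is proved directly (`sq_re_trace_mul_sub_le`): the trace norm is a pairing with a
contraction, the pairing is expanded in the eigenbases of both states, and weighted Cauchy–Schwarz
reduces it to a scalar inequality between eigenvalues. Alice's system is replaced by the code space
`Fin N`, where `τ_A` becomes `I/N`; an isometry carries the result back. -/

namespace QCoding

open Matrix
open scoped Matrix.Norms.L2Operator ComplexOrder

/-! ### Contractions and the trace norm. -/

section TraceNorm

variable {m n : Type*} [Fintype m] [Fintype n] [DecidableEq n]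

theorem l2_opNorm_le_one_of_isometry {W : Matrix m n ℂ} (hW : Wᴴ * W = 1) : ‖W‖ ≤ 1 := by
  have h := l2_opNorm_conjTranspose_mul_self W
  have h1 : ‖(1 : Matrix n n ℂ)‖ ≤ 1 := by
    rw [← diagonal_one, l2_opNorm_diagonal]
    exact (pi_norm_le_iff_of_nonneg zero_le_one).2 fun i => by simp
  rw [hW] at h
  nlinarith [norm_nonneg W]

theorem l2_opNorm_conj_le_one {k l : Type*} [Fintype k] [DecidableEq m] [Fintype l] [DecidableEq l]
    {X : Matrix k m ℂ} {T : Matrix m n ℂ} {Y : Matrix n l ℂ}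
    (hX : ‖X‖ ≤ 1) (hT : ‖T‖ ≤ 1) (hY : ‖Y‖ ≤ 1) : ‖X * T * Y‖ ≤ 1 :=
  (l2_opNorm_mul _ _).trans <| mul_le_one₀
    ((l2_opNorm_mul _ _).trans <| mul_le_one₀ hX (norm_nonneg _) hT) (norm_nonneg _) hY

theorem sum_norm_sq_col_le_one {B : Matrix m n ℂ} (hB : ‖B‖ ≤ 1) (j : n) :
    ∑ i, ‖B i j‖ ^ 2 ≤ 1 := by
  have h := l2_opNorm_mulVec B (EuclideanSpace.single j 1)
  have h2 : ‖(EuclideanSpace.equiv m ℂ).symm (B *ᵥ (EuclideanSpace.single j (1 : ℂ)).ofLp)‖ ^ 2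
      = ∑ i, ‖B i j‖ ^ 2 := by
    rw [EuclideanSpace.norm_sq_eq]
    simp
  rw [← h2]
  have h3 : ‖(EuclideanSpace.single j (1 : ℂ))‖ = 1 := by simp
  rw [h3, mul_one] at h
  exact pow_le_one₀ (norm_nonneg _) (h.trans hB)

theorem sum_norm_sq_row_le_one [DecidableEq m] {B : Matrix m n ℂ} (hB : ‖B‖ ≤ 1) (i : m) :
    ∑ j, ‖B i j‖ ^ 2 ≤ 1 := by
  have h := sum_norm_sq_col_le_one (B := Bᴴ) (by rwa [l2_opNorm_conjTranspose]) i
  simpa using h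

/-- The spectral theorem in the form `A = U D Uᴴ`. -/
theorem isHermitian_eq_mul_diagonal_mul {A : Matrix n n ℂ} (hA : A.IsHermitian) :
    A = (hA.eigenvectorUnitary : Matrix n n ℂ) * diagonal (fun i => (hA.eigenvalues i : ℂ)) *
      (hA.eigenvectorUnitary : Matrix n n ℂ)ᴴ := by
  conv_lhs => rw [hA.spectral_theorem, Unitary.conjStarAlgAut_apply]
  rfl

theorem isHermitian_cfc_eq {A : Matrix n n ℂ} (hA : A.IsHermitian) (f : ℝ → ℝ) :
    cfc f A = (hA.eigenvectorUnitary : Matrix n n ℂ) *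
      diagonal (fun i => (f (hA.eigenvalues i) : ℂ)) *
      (hA.eigenvectorUnitary : Matrix n n ℂ)ᴴ := by
  rw [hA.cfc_eq, IsHermitian.cfc, Unitary.conjStarAlgAut_apply]
  rfl

theorem eigenvectorUnitary_conjTranspose_mul {A : Matrix n n ℂ} (hA : A.IsHermitian) :
    (hA.eigenvectorUnitary : Matrix n n ℂ)ᴴ * (hA.eigenvectorUnitary : Matrix n n ℂ) = 1 :=
  Unitary.coe_star_mul_self hA.eigenvectorUnitary

/-- The trace norm of a Hermitian matrix is attained as a pairing with a contraction. -/
theorem exists_traceNorm_eq_trace_mul {M : Matrix n n ℂ} (hM : M.IsHermitian) :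
    ∃ T : Matrix n n ℂ, ‖T‖ ≤ 1 ∧ traceNorm M = (T * M).trace.re := by
  set U := (hM.eigenvectorUnitary : Matrix n n ℂ) with hU
  have hUU : Uᴴ * U = 1 := eigenvectorUnitary_conjTranspose_mul hM
  -- The witness is the sign of `M`, since `sgn(M) M = |M|`.
  refine ⟨U * diagonal (fun i => ((SignType.sign (hM.eigenvalues i) : ℝ) : ℂ)) * Uᴴ, ?_, ?_⟩
  · refine l2_opNorm_conj_le_one (l2_opNorm_le_one_of_isometry hUU) ?_
      ((l2_opNorm_conjTranspose U).trans_le (l2_opNorm_le_one_of_isometry hUU))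
    rw [l2_opNorm_diagonal]
    refine (pi_norm_le_iff_of_nonneg zero_le_one).2 fun i => ?_
    rcases lt_trichotomy (hM.eigenvalues i) 0 with h | h | h <;> simp [h]
  · have h1 : cfc Real.sqrt (Mᴴ * M) = cfc (fun x : ℝ => |x|) M := by
      rw [hM.eq, ← pow_two, ← cfc_comp_pow Real.sqrt 2 M Real.continuous_sqrt.continuousOn
        hM.isSelfAdjoint]
      simp only [Real.sqrt_sq_eq_abs]
    rw [traceNorm, h1, isHermitian_cfc_eq hM]
    conv_rhs => enter [1, 1, 2]; rw [isHermitian_eq_mul_diagonal_mul hM]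
    rw [← hU]
    congr 2
    have h2 : ∀ D E : Matrix n n ℂ, U * D * Uᴴ * (U * E * Uᴴ) = U * (D * E) * Uᴴ := by
      intro D E
      calc _ = U * D * (Uᴴ * U) * E * Uᴴ := by simp only [Matrix.mul_assoc]
        _ = _ := by rw [hUU]; simp only [Matrix.mul_assoc, Matrix.mul_one]
    rw [h2, diagonal_mul_diagonal]
    congr! 3
    ext i
    rw [← Complex.ofReal_mul, sign_mul_self]

end TraceNorm

/-! ### Pinsker's inequality from a scalar bound. -/

section Pinsker

theorem hasDerivAt_log_sub_div {x : ℝ} (hx : 0 < x) :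
    HasDerivAt (fun x : ℝ => Real.log x - (x - 1) * (5 * x + 1) / (2 * x * (x + 2)))
      ((x - 1) ^ 3 / (x ^ 2 * (x + 2) ^ 2)) x := by
  have h1 : HasDerivAt (fun x : ℝ => (x - 1) * (5 * x + 1))
      (1 * (5 * x + 1) + (x - 1) * (5 * 1)) x :=
    ((hasDerivAt_id' x).sub_const 1).mul (((hasDerivAt_id' x).const_mul 5).add_const 1)
  have h2 : HasDerivAt (fun x : ℝ => 2 * x * (x + 2)) (2 * 1 * (x + 2) + 2 * x * 1) x :=
    ((hasDerivAt_id' x).const_mul 2).mul ((hasDerivAt_id' x).add_const 2)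
  refine ((Real.hasDerivAt_log hx.ne').sub (h1.div h2 (by positivity))).congr_deriv ?_
  field_simp
  ring

/-- The rational function is what the quadratic bound on `r log (r/s) - r + s` becomes for `x = r /
s`. The difference of the two sides vanishes at `1`, and its derivative has the sign of `(x - 1) ^
3`, so `1` is its minimum. -/
theorem sub_one_mul_div_le_log {x : ℝ} (hx : 0 < x) :
    (x - 1) * (5 * x + 1) / (2 * x * (x + 2)) ≤ Real.log x := by
  set f : ℝ → ℝ := fun x => Real.log x - (x - 1) * (5 * x + 1) / (2 * x * (x + 2)) with hf
  have hd : ∀ x : ℝ, 0 < x → HasDerivAt f ((x - 1) ^ 3 / (x ^ 2 * (x + 2) ^ 2)) x :=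
    fun x hx => hasDerivAt_log_sub_div hx
  have h1 : f 1 = 0 := by simp [hf]
  suffices f 1 ≤ f x by rw [h1] at this; exact sub_nonneg.1 this
  rcases le_total x 1 with hx1 | hx1
  · have hpos : ∀ y ∈ Set.Icc x 1, 0 < y := fun y hy => hx.trans_le hy.1
    refine antitoneOn_of_deriv_nonpos (convex_Icc x 1)
      (fun y hy => (hd y (hpos y hy)).continuousAt.continuousWithinAt)
      (fun y hy => (hd y (hpos y (interior_subset hy))).differentiableAt.differentiableWithinAt)
      (fun y hy => ?_) ⟨le_rfl, hx1⟩ ⟨hx1, le_rfl⟩ hx1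
    have hy' := interior_subset hy
    rw [(hd y (hpos y hy')).deriv]
    exact div_nonpos_of_nonpos_of_nonneg
      (Odd.pow_nonpos (by decide) (sub_nonpos.2 hy'.2)) (by positivity)
  · have hpos : ∀ y ∈ Set.Icc 1 x, 0 < y := fun y hy => zero_lt_one.trans_le hy.1
    refine monotoneOn_of_deriv_nonneg (convex_Icc 1 x)
      (fun y hy => (hd y (hpos y hy)).continuousAt.continuousWithinAt)
      (fun y hy => (hd y (hpos y (interior_subset hy))).differentiableAt.differentiableWithinAt)
      (fun y hy => ?_) ⟨le_rfl, hx1⟩ ⟨hx1, le_rfl⟩ hx1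
    have hy' := interior_subset hy
    rw [(hd y (hpos y hy')).deriv]
    exact div_nonneg (pow_nonneg (sub_nonneg.2 hy'.1) 3) (by positivity)

/-- A quadratic lower bound for the integrand of the relative entropy. -/
theorem sq_sub_div_le_mul_log_sub {r s : ℝ} (hr : 0 ≤ r) (hs : 0 < s) :
    3 * (r - s) ^ 2 / (r + 2 * s) ≤ 2 * (r * (Real.log r - Real.log s) - r + s) := by
  rcases hr.eq_or_lt with rfl | hr
  · rw [div_le_iff₀ (by positivity)]
    nlinarith
  · have h := sub_one_mul_div_le_log (div_pos hr hs)
    rw [Real.log_div hr.ne' hs.ne'] at h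
    have h2 := mul_le_mul_of_nonneg_left h hr.le
    have h3 : 3 * (r - s) ^ 2 / (r + 2 * s)
        = 2 * (r * ((r / s - 1) * (5 * (r / s) + 1) / (2 * (r / s) * (r / s + 2))) - r + s) := by
      field_simp
      ring
    rw [h3]
    linarith

variable {n : Type*} [Fintype n] [DecidableEq n]

/-- Inserting `V * Vᴴ` in one term and `U * Uᴴ` in the other gives both the same coefficients, so
that only eigenvalue differences appear. -/
theorem trace_mul_conj_diagonal {U V T : Matrix n n ℂ} (hU : Uᴴ * U = 1) (hV : Vᴴ * V = 1)
    (r s : n → ℝ) :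
    (T * (U * diagonal (fun i => (r i : ℂ)) * Uᴴ - V * diagonal (fun j => (s j : ℂ)) * Vᴴ)).trace
      = ∑ i, ∑ j, (Uᴴ * V) i j * (Vᴴ * T * U) j i * ((r i - s j : ℝ) : ℂ) := by
  have hU' : U * Uᴴ = 1 := mul_eq_one_comm.1 hU
  have hV' : V * Vᴴ = 1 := mul_eq_one_comm.1 hV
  have h1 : (T * (U * diagonal (fun i => (r i : ℂ)) * Uᴴ)).trace
      = (diagonal (fun i => (r i : ℂ)) * ((Uᴴ * V) * (Vᴴ * T * U))).trace := by
    calc _ = (diagonal (fun i => (r i : ℂ)) * (Uᴴ * T * U)).trace := by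
          rw [Matrix.mul_assoc U, ← Matrix.mul_assoc T, Matrix.trace_mul_comm]
          simp only [Matrix.mul_assoc]
      _ = (diagonal (fun i => (r i : ℂ)) * (Uᴴ * (V * Vᴴ) * T * U)).trace := by
          rw [hV', Matrix.mul_one]
      _ = _ := by simp only [Matrix.mul_assoc]
  have h2 : (T * (V * diagonal (fun i => (s i : ℂ)) * Vᴴ)).trace
      = (diagonal (fun i => (s i : ℂ)) * ((Vᴴ * T * U) * (Uᴴ * V))).trace := by
    calc _ = (diagonal (fun i => (s i : ℂ)) * (Vᴴ * T * V)).trace := by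
          rw [Matrix.mul_assoc V, ← Matrix.mul_assoc T, Matrix.trace_mul_comm]
          simp only [Matrix.mul_assoc]
      _ = (diagonal (fun i => (s i : ℂ)) * (Vᴴ * T * (U * Uᴴ) * V)).trace := by
          rw [hU', Matrix.mul_one]
      _ = _ := by simp only [Matrix.mul_assoc]
  rw [Matrix.mul_sub, trace_sub, h1, h2]
  simp only [trace, diag_apply, diagonal_mul]
  simp only [Matrix.mul_apply (M := Uᴴ * V) (N := Vᴴ * T * U),
    Matrix.mul_apply (M := Vᴴ * T * U) (N := Uᴴ * V), Finset.mul_sum]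
  rw [Finset.sum_comm (γ := n) (f := fun x i => (s x : ℂ) * _), ← Finset.sum_sub_distrib]
  refine Finset.sum_congr rfl fun i _ => ?_
  rw [← Finset.sum_sub_distrib]
  refine Finset.sum_congr rfl fun j _ => ?_
  push_cast
  ring

theorem sum_norm_sq_row_of_unitary {C : Matrix n n ℂ} (hC : C * Cᴴ = 1) (i : n) :
    ∑ j, ‖C i j‖ ^ 2 = 1 := by
  have h := congr_fun (congr_fun hC i) i
  simp only [Matrix.mul_apply, conjTranspose_apply, one_apply_eq, RCLike.star_def,
    Complex.mul_conj, Complex.normSq_eq_norm_sq] at h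
  exact_mod_cast h

theorem sum_norm_sq_col_of_unitary {C : Matrix n n ℂ} (hC : Cᴴ * C = 1) (j : n) :
    ∑ i, ‖C i j‖ ^ 2 = 1 := by
  have h := sum_norm_sq_row_of_unitary (C := Cᴴ) (by simpa using hC) j
  simpa using h

/-- Pinsker's inequality for matrices, in terms of spectral decompositions of both states: the sum
on the right is the relative entropy, in nats. -/
theorem sq_re_trace_mul_sub_le {U V T : Matrix n n ℂ} (hU : Uᴴ * U = 1) (hV : Vᴴ * V = 1)
    (hT : ‖T‖ ≤ 1) {r s : n → ℝ} (hr : ∀ i, 0 ≤ r i) (hs : ∀ j, 0 ≤ s j)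
    (hr1 : ∑ i, r i = 1) (hs1 : ∑ j, s j = 1)
    (hsupp : ∀ i j, s j = 0 → ‖(Uᴴ * V) i j‖ ^ 2 * r i = 0) :
    (T * (U * diagonal (fun i => (r i : ℂ)) * Uᴴ
        - V * diagonal (fun j => (s j : ℂ)) * Vᴴ)).trace.re ^ 2
      ≤ 2 * ∑ i, ∑ j, ‖(Uᴴ * V) i j‖ ^ 2 * r i * (Real.log (r i) - Real.log (s j)) := by
  have hV' : V * Vᴴ = 1 := mul_eq_one_comm.1 hV
  rw [trace_mul_conj_diagonal hU hV]
  have hB : ‖Vᴴ * T * U‖ ≤ 1 := l2_opNorm_conj_le_one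
    ((l2_opNorm_conjTranspose V).trans_le (l2_opNorm_le_one_of_isometry hV)) hT
    (l2_opNorm_le_one_of_isometry hU)
  have hC1 : (Uᴴ * V) * (Uᴴ * V)ᴴ = 1 := by
    rw [conjTranspose_mul, conjTranspose_conjTranspose, Matrix.mul_assoc, ← Matrix.mul_assoc V,
      hV', Matrix.one_mul, hU]
  have hC2 : (Uᴴ * V)ᴴ * (Uᴴ * V) = 1 := mul_eq_one_comm.1 hC1
  set C := Uᴴ * V
  set B := Vᴴ * T * U
  clear_value B C
  -- Cauchy–Schwarz with weights `(r i + 2 * s j) / 3`: paired with the squared entries of a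
  -- contraction they sum to at most `(1 + 2) / 3 = 1`, and their inverses produce the left side of
  -- the scalar bound.
  have key : (∑ i, ∑ j, ‖C i j‖ * ‖B j i‖ * |r i - s j|) ^ 2
      ≤ (∑ i, ∑ j, ‖C i j‖ ^ 2 * (3 * (r i - s j) ^ 2 / (r i + 2 * s j)))
        * ∑ i, ∑ j, ‖B j i‖ ^ 2 * ((r i + 2 * s j) / 3) := by
    simp only [← Finset.sum_product']
    refine Finset.sum_sq_le_sum_mul_sum_of_sq_le_mul _ ?_ ?_ ?_
    · intro p _
      have := hr p.1
      have := hs p.2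
      positivity
    · intro p _
      have := hr p.1
      have := hs p.2
      positivity
    · intro p _
      have h1 := hr p.1
      have h2 := hs p.2
      rcases (add_nonneg h1 (mul_nonneg zero_le_two h2)).eq_or_lt with h | h
      · have h3 : r p.1 = 0 := by linarith
        have h4 : s p.2 = 0 := by linarith
        simp [h3, h4]
      · rw [mul_pow, mul_pow, sq_abs]
        have h' : r p.1 + s p.2 * 2 ≠ 0 := by linarith
        apply le_of_eq
        field_simp
  have hBsum : ∑ i, ∑ j, ‖B j i‖ ^ 2 * ((r i + 2 * s j) / 3) ≤ 1 := by
    have e1 : ∑ i, ∑ j, ‖B j i‖ ^ 2 * ((r i + 2 * s j) / 3)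
        = (∑ i, r i * ∑ j, ‖B j i‖ ^ 2) / 3 + 2 * (∑ j, s j * ∑ i, ‖B j i‖ ^ 2) / 3 := by
      simp only [Finset.mul_sum, Finset.sum_div]
      rw [Finset.sum_comm (f := fun j i => 2 * (s j * ‖B j i‖ ^ 2) / 3), ← Finset.sum_add_distrib]
      refine Finset.sum_congr rfl fun i _ => ?_
      rw [← Finset.sum_add_distrib]
      exact Finset.sum_congr rfl fun j _ => by ring
    have e2 : ∑ i, r i * ∑ j, ‖B j i‖ ^ 2 ≤ ∑ i, r i :=
      Finset.sum_le_sum fun i _ => mul_le_of_le_one_right (hr i) (sum_norm_sq_col_le_one hB i)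
    have e3 : ∑ j, s j * ∑ i, ‖B j i‖ ^ 2 ≤ ∑ j, s j :=
      Finset.sum_le_sum fun j _ => mul_le_of_le_one_right (hs j) (sum_norm_sq_row_le_one hB j)
    rw [e1]
    linarith
  have hCsum : ∑ i, ∑ j, ‖C i j‖ ^ 2 * (3 * (r i - s j) ^ 2 / (r i + 2 * s j))
      ≤ 2 * ∑ i, ∑ j, ‖C i j‖ ^ 2 * r i * (Real.log (r i) - Real.log (s j)) := by
    -- The `‖C i j‖ ^ 2` are doubly stochastic, so the linear terms `-r + s` of the scalar bound
    -- cancel in the sum.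
    have e1 : ∑ i, ∑ j, ‖C i j‖ ^ 2 * r i = 1 := by
      simp only [← Finset.sum_mul, sum_norm_sq_row_of_unitary hC1, one_mul, hr1]
    have e2 : ∑ i, ∑ j, ‖C i j‖ ^ 2 * s j = 1 := by
      rw [Finset.sum_comm]
      simp only [← Finset.sum_mul, sum_norm_sq_col_of_unitary hC2, one_mul, hs1]
    have e3 : ∑ i, ∑ j, ‖C i j‖ ^ 2 * (3 * (r i - s j) ^ 2 / (r i + 2 * s j))
        ≤ ∑ i, ∑ j, (2 * (‖C i j‖ ^ 2 * r i * (Real.log (r i) - Real.log (s j)))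
          - 2 * (‖C i j‖ ^ 2 * r i) + 2 * (‖C i j‖ ^ 2 * s j)) := by
      refine Finset.sum_le_sum fun i _ => Finset.sum_le_sum fun j _ => ?_
      -- At `s j = 0` the scalar bound is unavailable and `Real.log 0 = 0` is a junk value; the
      -- support condition makes both sides vanish.
      rcases (hs j).eq_or_lt with h | h
      · rw [← h, hsupp i j h.symm]
        rcases mul_eq_zero.1 (hsupp i j h.symm) with h1 | h1 <;> simp [h1]
      · have := mul_le_mul_of_nonneg_left (sq_sub_div_le_mul_log_sub (hr i) h)
          (sq_nonneg ‖C i j‖)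
        linarith
    simp only [Finset.sum_add_distrib, Finset.sum_sub_distrib, ← Finset.mul_sum, e1, e2] at e3
    linarith
  have hnorm : |(∑ i, ∑ j, C i j * B j i * ((r i - s j : ℝ) : ℂ)).re|
      ≤ ∑ i, ∑ j, ‖C i j‖ * ‖B j i‖ * |r i - s j| := by
    refine (Complex.abs_re_le_norm _).trans <| (norm_sum_le _ _).trans <|
      Finset.sum_le_sum fun i _ => (norm_sum_le _ _).trans <| Finset.sum_le_sum fun j _ => ?_
    rw [norm_mul, norm_mul, Complex.norm_real, Real.norm_eq_abs]
  have hC0 : 0 ≤ ∑ i, ∑ j, ‖C i j‖ ^ 2 * (3 * (r i - s j) ^ 2 / (r i + 2 * s j)) := by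
    refine Finset.sum_nonneg fun i _ => Finset.sum_nonneg fun j _ => ?_
    have := hr i
    have := hs j
    positivity
  calc _ = |(∑ i, ∑ j, C i j * B j i * ((r i - s j : ℝ) : ℂ)).re| ^ 2 := (sq_abs _).symm
    _ ≤ _ := pow_le_pow_left₀ (abs_nonneg _) hnorm 2
    _ ≤ _ := key
    _ ≤ _ := mul_le_of_le_one_right hC0 hBsum
    _ ≤ _ := hCsum

end Pinsker

/-! ### Entropy of the marginals of a pure state. -/

section Entropy

variable {m n : Type*} [Fintype m] [DecidableEq m] [Fintype n] [DecidableEq n]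

theorem vnEntropy_eq_sum {A : Matrix n n ℂ} (hA : A.IsHermitian) :
    vnEntropy A = -∑ i, hA.eigenvalues i * Real.logb 2 (hA.eigenvalues i) := by
  have hUU := eigenvectorUnitary_conjTranspose_mul hA
  rw [vnEntropy, isHermitian_cfc_eq hA]
  conv_lhs => enter [1, 1, 1, 1]; rw [isHermitian_eq_mul_diagonal_mul hA]
  set U := (hA.eigenvectorUnitary : Matrix n n ℂ)
  have h2 : ∀ D E : Matrix n n ℂ, (U * D * Uᴴ * (U * E * Uᴴ)).trace = (D * E).trace := by
    intro D E
    calc _ = (U * (D * (Uᴴ * U) * E * Uᴴ)).trace := by simp only [Matrix.mul_assoc]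
      _ = (D * E * (Uᴴ * U)).trace := by
        rw [hUU, trace_mul_comm]; simp only [Matrix.mul_assoc, Matrix.mul_one, hUU]
      _ = _ := by rw [hUU, Matrix.mul_one]
  rw [h2, diagonal_mul_diagonal, trace_diagonal]
  norm_cast

/-- `G` intertwines `Gᴴ * G` and `G * Gᴴ`, hence also their powers. -/
theorem aeval_mul_conjTranspose_mul (G : Matrix m n ℂ) (q : Polynomial ℝ) :
    Polynomial.aeval (G * Gᴴ) q * G = G * Polynomial.aeval (Gᴴ * G) q := by
  induction q using Polynomial.induction_on' with
  | add p q hp hq => simp only [map_add, Matrix.add_mul, Matrix.mul_add, hp, hq]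
  | monomial k c =>
    simp only [Polynomial.aeval_monomial, Algebra.algebraMap_eq_smul_one, smul_mul_assoc, one_mul,
      Matrix.smul_mul, Matrix.mul_smul]
    congr 1
    induction k with
    | zero => simp
    | succ k ih =>
      rw [pow_succ', Matrix.mul_assoc, ih, pow_succ']
      simp only [Matrix.mul_assoc]

theorem aeval_transpose (A : Matrix n n ℂ) (q : Polynomial ℝ) :
    Polynomial.aeval Aᵀ q = (Polynomial.aeval A q)ᵀ := by
  induction q using Polynomial.induction_on' with
  | add p q hp hq => simp only [map_add, transpose_add, hp, hq]
  | monomial k c =>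
    simp only [Polynomial.aeval_monomial, Algebra.algebraMap_eq_smul_one, smul_mul_assoc, one_mul,
      transpose_smul, transpose_pow]

/-- The two marginals of a pure state have the same entropy. -/
theorem vnEntropy_mul_conjTranspose (G : Matrix m n ℂ) :
    vnEntropy (G * Gᴴ) = vnEntropy (Gᴴ * G)ᵀ := by
  have h1 : (G * Gᴴ).IsHermitian := isHermitian_mul_conjTranspose_self G
  have h2 : (Gᴴ * G)ᵀ.IsHermitian := (isHermitian_conjTranspose_mul_self G).transpose
  -- Interpolating the logarithm on both finite spectra at once lets a single polynomial replace it
  -- on both sides.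
  set S : Finset ℝ := (finite_real_spectrum (A := G * Gᴴ)).toFinset ∪
    (finite_real_spectrum (A := (Gᴴ * G)ᵀ)).toFinset
  set q : Polynomial ℝ := Lagrange.interpolate S id (Real.logb 2)
  have hval : ∀ x ∈ S, Real.logb 2 x = q.eval x := fun x hx =>
    (Lagrange.eval_interpolate_at_node (v := id) (Real.logb 2) Function.injective_id.injOn hx).symm
  have e1 : cfc (Real.logb 2) (G * Gᴴ) = Polynomial.aeval (G * Gᴴ) q := by
    rw [← cfc_polynomial q (G * Gᴴ) h1.isSelfAdjoint]
    exact cfc_congr fun x hx => hval x <|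
      Finset.mem_union_left _ ((Set.Finite.mem_toFinset _).2 hx)
  have e2 : cfc (Real.logb 2) (Gᴴ * G)ᵀ = Polynomial.aeval (Gᴴ * G)ᵀ q := by
    rw [← cfc_polynomial q (Gᴴ * G)ᵀ h2.isSelfAdjoint]
    exact cfc_congr fun x hx => hval x <|
      Finset.mem_union_right _ ((Set.Finite.mem_toFinset _).2 hx)
  rw [vnEntropy, vnEntropy, e1, e2, aeval_transpose, ← transpose_mul, trace_transpose,
    trace_mul_comm, ← Matrix.mul_assoc, aeval_mul_conjTranspose_mul, trace_mul_comm,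
    ← Matrix.mul_assoc, trace_mul_comm]

end Entropy

/-! ### Relative entropy to a product with the completely mixed state. -/

section RelativeEntropy

variable {ι κ e l : Type*} [Fintype ι]

/-- Cyclicity of the partial trace in the traced factor. It serves both to diagonalize Eve's
marginal and to remove Alice's isometry. -/
theorem traceA_kronecker_mul_mul [DecidableEq ι] [Fintype κ] [Fintype e]
    {P : Matrix κ ι ℂ} {Q : Matrix ι κ ℂ} (hQP : Q * P = 1)
    (X : Matrix l e ℂ) (Y : Matrix e l ℂ) (M : Matrix (ι × e) (ι × e) ℂ) :
    traceA ((P ⊗ₖ X) * M * (Q ⊗ₖ Y)) = X * traceA M * Y := by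
  have h1 : ∀ i j : ι, ∑ x, Q j x * P x i = if j = i then 1 else 0 := fun i j => by
    rw [← Matrix.mul_apply, hQP, Matrix.one_apply]
  ext k k'
  simp only [traceA, of_apply, Matrix.mul_apply, kroneckerMap_apply, Fintype.sum_prod_type,
    Finset.sum_mul, Finset.mul_sum]
  calc _ = ∑ j, ∑ l', ∑ i, ∑ l, (∑ x, Q j x * P x i) * (X k l * M (i, l) (j, l') * Y l' k') := by
        rw [Finset.sum_comm]
        refine Finset.sum_congr rfl fun j _ => ?_
        rw [Finset.sum_comm]
        refine Finset.sum_congr rfl fun l' _ => ?_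
        rw [Finset.sum_comm]
        refine Finset.sum_congr rfl fun i _ => ?_
        rw [Finset.sum_comm]
        refine Finset.sum_congr rfl fun l _ => ?_
        rw [Finset.sum_mul]
        exact Finset.sum_congr rfl fun x _ => by ring
    _ = ∑ j, ∑ l', ∑ l, X k l * M (j, l) (j, l') * Y l' k' := by
        refine Finset.sum_congr rfl fun j _ => Finset.sum_congr rfl fun l' _ => ?_
        rw [Finset.sum_comm]
        refine Finset.sum_congr rfl fun l _ => ?_
        simp [h1]
    _ = _ := by
        rw [Finset.sum_comm]
        refine Finset.sum_congr rfl fun l' _ => ?_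
        rw [Finset.sum_comm]

theorem trace_traceA [Fintype e] (M : Matrix (ι × e) (ι × e) ℂ) : (traceA M).trace = M.trace := by
  simp only [trace, diag_apply, traceA, of_apply, Fintype.sum_prod_type]
  exact Finset.sum_comm

theorem isHermitian_traceA {M : Matrix (ι × e) (ι × e) ℂ} (hM : M.IsHermitian) :
    (traceA M).IsHermitian := by
  ext k k'
  simp only [conjTranspose_apply, traceA, of_apply, star_sum]
  exact Finset.sum_congr rfl fun i _ => hM.apply _ _

variable [DecidableEq ι] [Fintype e] [DecidableEq e]

/-- Pinsker's inequality for a bipartite state compared with the product of the completely mixed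
state and its second marginal. -/
theorem sq_re_trace_mul_sub_mixed_le [Nonempty ι] {ρ T : Matrix (ι × e) (ι × e) ℂ}
    (hρ : ρ.PosSemidef) (hρ1 : ρ.trace = 1) (hT : ‖T‖ ≤ 1) :
    (T * (ρ - ((Fintype.card ι : ℂ)⁻¹ • (1 : Matrix ι ι ℂ)) ⊗ₖ traceA ρ)).trace.re ^ 2
      ≤ 2 * Real.log 2 *
        (vnEntropy (traceA ρ) + Real.logb 2 (Fintype.card ι) - vnEntropy ρ) := by
  have hE : (traceA ρ).IsHermitian := isHermitian_traceA hρ.1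
  set N : ℕ := Fintype.card ι with hN
  have hN0 : (0 : ℝ) < N := by exact_mod_cast Fintype.card_pos
  set U := (hρ.1.eigenvectorUnitary : Matrix (ι × e) (ι × e) ℂ)
  set Z := (hE.eigenvectorUnitary : Matrix e e ℂ)
  set r := hρ.1.eigenvalues
  set lam := hE.eigenvalues
  set V : Matrix (ι × e) (ι × e) ℂ := (1 : Matrix ι ι ℂ) ⊗ₖ Z with hVdef
  set s : ι × e → ℝ := fun x => lam x.2 / N with hs
  have hUU : Uᴴ * U = 1 := eigenvectorUnitary_conjTranspose_mul hρ.1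
  have hZZ : Zᴴ * Z = 1 := eigenvectorUnitary_conjTranspose_mul hE
  have hVc : Vᴴ = (1 : Matrix ι ι ℂ) ⊗ₖ Zᴴ := by
    rw [hVdef, conjTranspose_kronecker, conjTranspose_one]
  have hVV : Vᴴ * V = 1 := by
    rw [hVc, hVdef, ← mul_kronecker_mul, hZZ, Matrix.one_mul, one_kronecker_one]
  have hVV' : V * Vᴴ = 1 := mul_eq_one_comm.1 hVV
  have hρeq : ρ = U * diagonal (fun i => (r i : ℂ)) * Uᴴ := isHermitian_eq_mul_diagonal_mul hρ.1
  have hEeq : traceA ρ = Z * diagonal (fun i => (lam i : ℂ)) * Zᴴ :=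
    isHermitian_eq_mul_diagonal_mul hE
  have hr : ∀ i, 0 ≤ r i := hρ.eigenvalues_nonneg
  have hr1 : ∑ i, r i = 1 := by
    have h : ((∑ i, r i : ℝ) : ℂ) = 1 := by
      rw [← hρ1, hρ.1.trace_eq_sum_eigenvalues, Complex.ofReal_sum]
      rfl
    exact_mod_cast h
  have hlam1 : ∑ m, lam m = 1 := by
    have h : ((∑ m, lam m : ℝ) : ℂ) = 1 := by
      rw [← hρ1, ← trace_traceA, hE.trace_eq_sum_eigenvalues, Complex.ofReal_sum]
      rfl
    exact_mod_cast h
  set C := Uᴴ * V with hC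
  -- `p` is the diagonal of `ρ` in the product basis. Summed over the first factor it gives the
  -- eigenvalues of the marginal; their nonnegativity and the support condition both follow.
  set p : ι × e → ℝ := fun j => ∑ i, ‖C i j‖ ^ 2 * r i with hp
  have hp0 : ∀ j, 0 ≤ p j := fun j =>
    Finset.sum_nonneg fun i _ => mul_nonneg (sq_nonneg _) (hr i)
  have hpdiag : ∀ j, (Vᴴ * ρ * V) j j = (p j : ℂ) := by
    intro j
    have h1 : Vᴴ * ρ * V = Cᴴ * (diagonal (fun i => (r i : ℂ)) * C) := by
      rw [hC, conjTranspose_mul, conjTranspose_conjTranspose, hρeq]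
      simp only [Matrix.mul_assoc]
    rw [h1, Matrix.mul_apply, hp]
    push_cast
    refine Finset.sum_congr rfl fun i _ => ?_
    rw [conjTranspose_apply, diagonal_mul, RCLike.star_def, mul_left_comm, Complex.conj_mul']
    ring
  have hpsum : ∀ m, ∑ x, p (x, m) = lam m := by
    intro m
    have h1 : traceA (Vᴴ * ρ * V) = diagonal (fun i => (lam i : ℂ)) := by
      rw [hVc, hVdef, traceA_kronecker_mul_mul (Matrix.one_mul _), hEeq]
      calc _ = (Zᴴ * Z) * diagonal (fun i => (lam i : ℂ)) * (Zᴴ * Z) := by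
            simp only [Matrix.mul_assoc]
        _ = _ := by rw [hZZ, Matrix.one_mul, Matrix.mul_one]
    have h2 := congr_fun (congr_fun h1 m) m
    simp only [traceA, of_apply, hpdiag, diagonal_apply_eq] at h2
    exact_mod_cast h2
  have hlam : ∀ m, 0 ≤ lam m := fun m => hpsum m ▸ Finset.sum_nonneg fun x _ => hp0 _
  have hs0 : ∀ j, 0 ≤ s j := fun j => div_nonneg (hlam _) hN0.le
  have hs1 : ∑ j, s j = 1 := by
    rw [Fintype.sum_prod_type]
    simp only [hs, ← Finset.sum_div, hlam1, Finset.sum_const, Finset.card_univ, nsmul_eq_mul]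
    rw [← hN]
    field_simp
  have hsupp : ∀ i j, s j = 0 → ‖C i j‖ ^ 2 * r i = 0 := by
    rintro i ⟨x, m⟩ h
    have h1 : lam m = 0 := (div_eq_zero_iff.1 h).resolve_right hN0.ne'
    have h2 : p (x, m) = 0 :=
      (Finset.sum_eq_zero_iff_of_nonneg fun x _ => hp0 (x, m)).1 ((hpsum m).trans h1) x
        (Finset.mem_univ _)
    exact (Finset.sum_eq_zero_iff_of_nonneg fun i _ => mul_nonneg (sq_nonneg _) (hr i)).1 h2 i
      (Finset.mem_univ _)
  have hσ : ((N : ℂ)⁻¹ • (1 : Matrix ι ι ℂ)) ⊗ₖ traceA ρ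
      = V * diagonal (fun j => (s j : ℂ)) * Vᴴ := by
    have h1 : diagonal (fun j => (s j : ℂ))
        = ((N : ℂ)⁻¹ • (1 : Matrix ι ι ℂ)) ⊗ₖ diagonal (fun i => (lam i : ℂ)) := by
      rw [smul_one_eq_diagonal, diagonal_kronecker_diagonal]
      congr 1
      ext j
      simp only [hs]
      push_cast
      ring
    rw [h1, hVc, hVdef, ← mul_kronecker_mul, ← mul_kronecker_mul, Matrix.one_mul, Matrix.mul_one,
      hEeq]
  have main := sq_re_trace_mul_sub_le hUU hVV hT hr hs0 hr1 hs1 hsupp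
  rw [← hρeq, ← hσ, ← hC] at main
  refine main.trans_eq ?_
  have hlog2 : Real.log 2 ≠ 0 := (Real.log_pos one_lt_two).ne'
  have hC1 : C * Cᴴ = 1 := by
    rw [hC, conjTranspose_mul, conjTranspose_conjTranspose, Matrix.mul_assoc, ← Matrix.mul_assoc V,
      hVV', Matrix.one_mul, hUU]
  have e1 : ∑ i, ∑ j, ‖C i j‖ ^ 2 * r i * Real.log (r i) = ∑ i, r i * Real.log (r i) := by
    refine Finset.sum_congr rfl fun i _ => ?_
    rw [← Finset.sum_mul, ← Finset.sum_mul, sum_norm_sq_row_of_unitary hC1, one_mul]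
  -- The cross term sees `ρ` only through its second marginal, because `log (lam m / N)` does not
  -- depend on the first index.
  have e2 : ∑ i, ∑ j, ‖C i j‖ ^ 2 * r i * Real.log (s j)
      = ∑ m, lam m * Real.log (lam m) - Real.log N := by
    rw [Finset.sum_comm]
    simp only [← Finset.sum_mul]
    rw [Fintype.sum_prod_type, Finset.sum_comm]
    calc _ = ∑ m, lam m * Real.log (lam m / N) := by
          refine Finset.sum_congr rfl fun m _ => ?_
          exact (Finset.sum_mul _ _ _).symm.trans
            (congrArg (fun t => t * Real.log (lam m / N)) (hpsum m))
      _ = ∑ m, (lam m * Real.log (lam m) - lam m * Real.log N) := by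
          refine Finset.sum_congr rfl fun m _ => ?_
          rcases (hlam m).eq_or_lt with h | h
          · simp [← h]
          · rw [Real.log_div h.ne' hN0.ne', mul_sub]
      _ = _ := by rw [Finset.sum_sub_distrib, ← Finset.sum_mul, hlam1, one_mul]
  simp only [mul_sub, Finset.sum_sub_distrib, e1, e2]
  rw [vnEntropy_eq_sum hE, vnEntropy_eq_sum hρ.1]
  simp only [Real.logb, ← mul_div_assoc, ← Finset.sum_div]
  field_simp
  ring

end RelativeEntropy

/-! ### Output states of a code. -/

section Code

theorem mul_ketBra_mul_conjTranspose {m n : Type*} [Fintype n]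
    (A A' : Matrix m n ℂ) (v : n → ℂ) :
    A * ketBra v * A'ᴴ = vecMulVec (A *ᵥ v) (star (A' *ᵥ v)) := by
  rw [ketBra, mul_vecMulVec, vecMulVec_mul, star_mulVec]

variable {a a' b e : Type*} [Fintype a'] [DecidableEq a'] [Fintype b] [Fintype e]

/-- The joint amplitudes of Eve (rows) and Bob (columns) when the vector `v` is sent. -/
def Channel.amplitude (Λ : Channel a' b e) (v : a' → ℂ) : Matrix e b ℂ :=
  of fun k j => (Λ.kraus k *ᵥ v) j

/-- The amplitudes of the output for a code, with Alice and Eve labelling the rows. -/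
noncomputable def Channel.codeAmplitude {N : ℕ} (Λ : Channel a' b e)
    (α : Fin N → EuclideanSpace ℂ a') : Matrix (Fin N × e) b ℂ :=
  of fun x j => ((1 / Real.sqrt N : ℝ) : ℂ) * Λ.amplitude (α x.1) x.2 j

theorem Channel.toEve_ketBra (Λ : Channel a' b e) (v : a' → ℂ) :
    Λ.toEve (ketBra v) = Λ.amplitude v * (Λ.amplitude v)ᴴ := by
  ext k k'
  simp [toEve, mul_ketBra_mul_conjTranspose, amplitude, Matrix.mul_apply, trace, vecMulVec_apply]

theorem Channel.toBob_ketBra (Λ : Channel a' b e) (v : a' → ℂ) :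
    Λ.toBob (ketBra v) = ((Λ.amplitude v)ᴴ * Λ.amplitude v)ᵀ := by
  ext j j'
  simp [toBob, mul_ketBra_mul_conjTranspose, amplitude, Matrix.mul_apply, Matrix.sum_apply,
    vecMulVec_apply, mul_comm]

theorem Channel.trace_amplitude_mul_conjTranspose (Λ : Channel a' b e) (v : EuclideanSpace ℂ a') :
    (Λ.amplitude v * (Λ.amplitude v)ᴴ).trace = (‖v‖ ^ 2 : ℝ) := by
  rw [← Λ.toEve_ketBra]
  have h1 : (Λ.toEve (ketBra v)).trace = ((∑ k, (Λ.kraus k)ᴴ * Λ.kraus k) * ketBra v).trace := by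
    rw [Finset.sum_mul, trace_sum]
    refine Finset.sum_congr rfl fun k _ => ?_
    rw [diag_apply, toEve, of_apply, trace_mul_cycle]
  rw [h1, Λ.trace_preserving, Matrix.one_mul, ketBra, EuclideanSpace.norm_sq_eq]
  simp [trace, vecMulVec_apply, Complex.mul_conj']

variable {N : ℕ} (Λ : Channel a' b e) (α : Fin N → EuclideanSpace ℂ a')

theorem one_div_sqrt_mul_self : (((1 / Real.sqrt N : ℝ) : ℂ)) * ((1 / Real.sqrt N : ℝ) : ℂ)
    = ((1 / N : ℝ) : ℂ) := by
  rw [← Complex.ofReal_mul, div_mul_div_comm, Real.mul_self_sqrt N.cast_nonneg, one_mul]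

theorem sum_toEve_eq : ∑ i, ((1 / N : ℝ) : ℂ) • Λ.toEve (ketBra (α i))
    = traceA (Λ.codeAmplitude α * (Λ.codeAmplitude α)ᴴ) := by
  ext k k'
  simp only [Matrix.sum_apply, Matrix.smul_apply, Λ.toEve_ketBra, traceA, of_apply,
    Matrix.mul_apply, Channel.codeAmplitude, conjTranspose_apply, smul_eq_mul, Finset.mul_sum,
    ← one_div_sqrt_mul_self, RCLike.star_def, map_mul, Complex.conj_ofReal]
  exact Finset.sum_congr rfl fun i _ => Finset.sum_congr rfl fun j _ => by ring

theorem sum_toBob_eq : ∑ i, ((1 / N : ℝ) : ℂ) • Λ.toBob (ketBra (α i))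
    = ((Λ.codeAmplitude α)ᴴ * Λ.codeAmplitude α)ᵀ := by
  ext k k'
  simp only [Matrix.sum_apply, Matrix.smul_apply, Λ.toBob_ketBra, of_apply, transpose_apply,
    Matrix.mul_apply, Channel.codeAmplitude, conjTranspose_apply, smul_eq_mul, Finset.mul_sum,
    ← one_div_sqrt_mul_self, RCLike.star_def, map_mul, Complex.conj_ofReal, Fintype.sum_prod_type]
  exact Finset.sum_congr rfl fun i _ => Finset.sum_congr rfl fun j _ => by ring

theorem trace_codeAmplitude (hN : 0 < N) (hα : ∀ i, ‖α i‖ = 1) :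
    (Λ.codeAmplitude α * (Λ.codeAmplitude α)ᴴ).trace = 1 := by
  rw [← trace_traceA, ← sum_toEve_eq, trace_sum]
  simp only [trace_smul, Λ.toEve_ketBra, Λ.trace_amplitude_mul_conjTranspose, hα]
  have : (N : ℂ) ≠ 0 := by exact_mod_cast hN.ne'
  simp [this]

/-- The isometry from the abstract code space to the span of an orthonormal family. -/
def familyMatrix (ψ : Fin N → EuclideanSpace ℂ a) : Matrix a (Fin N) ℂ :=
  of fun x i => ψ i x

theorem familyMatrix_conjTranspose_mul [Fintype a] {ψ : Fin N → EuclideanSpace ℂ a}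
    (hψ : Orthonormal ℂ ψ) : (familyMatrix ψ)ᴴ * familyMatrix ψ = 1 := by
  ext i j
  rw [Matrix.one_apply, ← orthonormal_iff_ite.1 hψ i j, PiLp.inner_apply]
  simp [Matrix.mul_apply, familyMatrix, mul_comm]

/-- Alice's vectors enter only through an isometry on her side, so `σ_AE` is a conjugate of a state
on the code space and Eve. -/
theorem traceB_ketBra_send_codeState [DecidableEq e] (ψ : Fin N → EuclideanSpace ℂ a) :
    traceB (ketBra (Λ.send (codeState ψ α)))
      = (familyMatrix ψ ⊗ₖ (1 : Matrix e e ℂ)) * (Λ.codeAmplitude α * (Λ.codeAmplitude α)ᴴ) *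
        (familyMatrix ψ ⊗ₖ (1 : Matrix e e ℂ))ᴴ := by
  have h1 : ∀ x j k, Λ.send (codeState ψ α) (x, j, k)
      = ((familyMatrix ψ ⊗ₖ (1 : Matrix e e ℂ)) * Λ.codeAmplitude α) (x, k) j := by
    intro x j k
    simp only [Channel.send, codeState, Matrix.mul_apply, kroneckerMap_apply,
      Fintype.sum_prod_type, Matrix.one_apply, mul_ite, mul_one, mul_zero, ite_mul, zero_mul,
      familyMatrix, Channel.codeAmplitude, Channel.amplitude, of_apply, mulVec, dotProduct,
      Finset.mul_sum]
    rw [Finset.sum_comm]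
    refine Finset.sum_congr rfl fun i _ => ?_
    rw [Finset.sum_eq_single k (fun k' _ h => by simp [h.symm]) (by simp)]
    simp only [if_true]
    exact Finset.sum_congr rfl fun j _ => by ring
  rw [Matrix.mul_assoc, Matrix.mul_assoc, ← conjTranspose_mul, ← Matrix.mul_assoc]
  ext ⟨x, k⟩ ⟨x', k'⟩
  rw [Matrix.mul_apply]
  simp only [traceB, of_apply, ketBra, vecMulVec_apply, Pi.star_apply, h1, conjTranspose_apply]

theorem maxMixed_eq (ψ : Fin N → EuclideanSpace ℂ a) :
    maxMixed ψ = familyMatrix ψ * ((N : ℂ)⁻¹ • (1 : Matrix (Fin N) (Fin N) ℂ)) *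
      (familyMatrix ψ)ᴴ := by
  rw [maxMixed, one_div, Matrix.mul_smul, Matrix.mul_one, Matrix.smul_mul]
  congr 1
  ext x y
  simp [Matrix.sum_apply, ketBra, vecMulVec_apply, Matrix.mul_apply, familyMatrix]

/-- Purity is used twice: for each code word, to cancel the averaged entropies, and for the whole
superposition, to trade Bob's entropy for that of Alice and Eve. -/
theorem distE_add_logb_sub_distB [DecidableEq b] [DecidableEq e] :
    distE Λ α + (Real.logb 2 N - distB Λ α)
      = vnEntropy (traceA (Λ.codeAmplitude α * (Λ.codeAmplitude α)ᴴ)) + Real.logb 2 N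
        - vnEntropy (Λ.codeAmplitude α * (Λ.codeAmplitude α)ᴴ) := by
  have h : ∀ i, vnEntropy (Λ.toEve (ketBra (α i))) = vnEntropy (Λ.toBob (ketBra (α i))) :=
    fun i => by rw [Λ.toEve_ketBra, Λ.toBob_ketBra, vnEntropy_mul_conjTranspose]
  simp only [distE, distB, holevo, h]
  rw [sum_toEve_eq, sum_toBob_eq, vnEntropy_mul_conjTranspose (Λ.codeAmplitude α)]
  ring

end Code

end QCoding

/-! ### The bound on the quantum error. -/

open Matrix in
open scoped Matrix.Norms.L2Operator ComplexOrder in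
theorem mainTheorem3 {a a' b e : Type*}
    [Fintype a] [DecidableEq a] [Fintype a'] [DecidableEq a']
    [Fintype b] [DecidableEq b] [Fintype e] [DecidableEq e]
    (Λ : QCoding.Channel a' b e) (N : ℕ) (hN : 0 < N)
    (α : Fin N → EuclideanSpace ℂ a') (hα : ∀ i, ‖α i‖ = 1)
    (ψ : Fin N → EuclideanSpace ℂ a) (hψ : Orthonormal ℂ ψ) :
    0 ≤ QCoding.distE Λ α + (Real.logb 2 N - QCoding.distB Λ α) ∧
    QCoding.quantumError ψ (Λ.send (QCoding.codeState ψ α)) ≤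
      Real.sqrt (2 * Real.log 2) *
        Real.sqrt (QCoding.distE Λ α + (Real.logb 2 N - QCoding.distB Λ α)) := by
  have hN' : Nonempty (Fin N) := ⟨⟨0, hN⟩⟩
  rw [QCoding.distE_add_logb_sub_distB]
  have hρ := posSemidef_self_mul_conjTranspose (Λ.codeAmplitude α)
  have hρ1 := QCoding.trace_codeAmplitude Λ α hN hα
  have hlog : 0 < 2 * Real.log 2 := mul_pos two_pos (Real.log_pos one_lt_two)
  have pinsker : ∀ T : Matrix (Fin N × e) (Fin N × e) ℂ, ‖T‖ ≤ 1 → _ :=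
    fun T hT => QCoding.sq_re_trace_mul_sub_mixed_le hρ hρ1 hT
  rw [Fintype.card_fin] at pinsker
  have hΨ := QCoding.familyMatrix_conjTranspose_mul hψ
  have hAE := QCoding.traceB_ketBra_send_codeState Λ α ψ
  set ρ := Λ.codeAmplitude α * (Λ.codeAmplitude α)ᴴ
  set Ψ := QCoding.familyMatrix ψ
  set W : Matrix (a × e) (Fin N × e) ℂ := Ψ ⊗ₖ (1 : Matrix e e ℂ)
  set τ : Matrix (Fin N) (Fin N) ℂ := (N : ℂ)⁻¹ • 1
  set D := QCoding.vnEntropy (QCoding.traceA ρ) + Real.logb 2 N - QCoding.vnEntropy ρ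
  -- With `T = 0`, Pinsker already gives nonnegativity: a square is at most `2 * Real.log 2 * D`.
  have hD : 0 ≤ D := nonneg_of_mul_nonneg_right
    ((sq_nonneg _).trans (pinsker 0 (by simp))) hlog
  refine ⟨hD, ?_⟩
  have hWc : Wᴴ = Ψᴴ ⊗ₖ (1 : Matrix e e ℂ) := by
    rw [conjTranspose_kronecker, conjTranspose_one]
  have hW : ‖W‖ ≤ 1 := QCoding.l2_opNorm_le_one_of_isometry <| by
    rw [hWc, ← mul_kronecker_mul, hΨ, Matrix.one_mul, one_kronecker_one]
  have hE : QCoding.traceA (W * ρ * Wᴴ) = QCoding.traceA ρ := by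
    rw [hWc, QCoding.traceA_kronecker_mul_mul hΨ, Matrix.one_mul, Matrix.mul_one]
  have hdiff : W * ρ * Wᴴ - QCoding.maxMixed ψ ⊗ₖ QCoding.traceA (W * ρ * Wᴴ)
      = W * (ρ - τ ⊗ₖ QCoding.traceA ρ) * Wᴴ := by
    have h : W * (τ ⊗ₖ QCoding.traceA ρ) * Wᴴ
        = QCoding.maxMixed ψ ⊗ₖ QCoding.traceA ρ := by
      rw [hWc, ← mul_kronecker_mul, ← mul_kronecker_mul, Matrix.one_mul, Matrix.mul_one,
        QCoding.maxMixed_eq]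
    rw [hE, ← h, Matrix.mul_sub, Matrix.sub_mul]
  have hherm : (ρ - τ ⊗ₖ QCoding.traceA ρ).IsHermitian := by
    refine hρ.1.sub ?_
    rw [IsHermitian, conjTranspose_kronecker, (QCoding.isHermitian_traceA hρ.1).eq]
    simp [τ]
  obtain ⟨T, hT, hTM⟩ := QCoding.exists_traceNorm_eq_trace_mul
    (isHermitian_mul_mul_conjTranspose W hherm)
  -- The isometry moves onto the test operator, and `Wᴴ * T * W` is again a contraction, so Pinsker
  -- on the code space applies.
  have htr : (T * (W * (ρ - τ ⊗ₖ QCoding.traceA ρ) * Wᴴ)).trace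
      = (Wᴴ * T * W * (ρ - τ ⊗ₖ QCoding.traceA ρ)).trace := by
    rw [← Matrix.mul_assoc, trace_mul_comm]
    simp only [Matrix.mul_assoc]
  rw [QCoding.quantumError, hAE, hdiff, hTM, htr, ← Real.sqrt_mul hlog.le]
  exact Real.le_sqrt_of_sq_le <| pinsker _ <| QCoding.l2_opNorm_conj_le_one
    ((l2_opNorm_conjTranspose W).trans_le hW) hT hW
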